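/- Throughout, $\mathbb{N}=\{1,2,3,\dots\}$. A family $\mathcal U$ of subsets of a metric space $(X,d)$ is *uniformly bounded* if there is $R>0$ with $\operatorname{diam} U\le R$ for all $U\in\mathcal U$, and, for $r>0$, *$r$-disjoint* if $d(U,V)=\inf\{d(x,y)\mid x\in U,\ y\in V\}\ge r$ for all $U\ne V$ in $\mathcal U$. *Transfinite asymptotic dimension.* Let $\mathrm{Fin}\,\mathbb N$ be the collection of finite nonempty subsets of $\mathbb N$. For $M\subseteq \mathrm{Fin}\,\mathbb N$ and $a\in\mathbb N$ put $M^a=\{\tau\in\mathrm{Fin}\,\mathbb N\mid \tau\cup\{a\}\in M,\ a\notin\tau\}$. Define $\operatorname{Ord}M$, an ordinal or $\infty$, inductively: $\operatorname{Ord}M=0$ iff $M=\emptyset$; for $\alpha>0$, $\operatorname{Ord}M\le\alpha$ iff $\operatorname{Ord}M^a<\alpha$ for every $a\in\mathbb N$; $\operatorname{Ord}M$ is the least $\alpha$ with $\operatorname{Ord}M\le\alpha$, and $\infty$ if there is none. For a metric space $X$ let $A(X,d)$ be the set of all $\sigma\in\mathrm{Fin}\,\mathbb N$ for which there are no uniformly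 bounded families $\mathcal U_i$, $i\in\sigma$, of subsets of $X$ such that each $\mathcal U_i$ is $i$-disjoint and $\bigcup_{i\in\sigma}\mathcal U_i$ covers $X$. Then $\operatorname{trasdim}X=\operatorname{Ord}A(X,d)$. *Complementary-finite asymptotic dimension.* Write every ordinal as $\gamma=\lambda(\gamma)+n(\gamma)$ with $\lambda(\gamma)$ zero or a limit ordinal and $n(\gamma)\in\{0,1,2,\dots\}$. Define $\operatorname{coasdim}X$ inductively: $\operatorname{coasdim}X=-1$ iff $X=\emptyset$; $\operatorname{coasdim}X\le\gamma$ iff for every $r>0$ there are $r$-disjoint uniformly bounded families $\mathcal U_0,\dots,\mathcal U_{n(\gamma)}$ of subsets of $X$ such that $\operatorname{coasdim}\bigl(X\setminus\bigcup(\mathcal U_0\cup\dots\cup\mathcal U_{n(\gamma)})\bigr)<\lambda(\gamma)$; for nonempty $X$, $\operatorname{coasdim}X$ is the least ordinal $\gamma$ with $\operatorname{coasdim}X\le\gamma$, and $\infty$ if there is none. *The space.* For $n\ge1$ let $X_n\subseteq\mathbb R^n$ be the set of points all of whose coordinates, with the possible exception of one, lie in $n\mathbb Z$ (the union of the lines parallel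 to the coordinate axes through the points of the lattice $(n\mathbb Z)^n$). For $a=(a_1,\dots,a_l)\in X_l$ and $b=(b_1,\dots,b_k)\in X_k$ with $l\le k$ let $a'=(a_1,\dots,a_l,0,0,\dots)$ and $b'=(b_1,\dots,b_k,0,0,\dots)$ in $\bigoplus\mathbb R$, and let $c=0$ if $l=k$, $c=l+(l+1)+\dots+(k-1)$ if $l<k$. Put $d(a,b)=d(b,a)=\max\{d_{\max}(a',b'),c\}$, where $d_{\max}$ is the maximum metric on $\bigoplus\mathbb R$. This is a metric on the disjoint union $\bigsqcup_{n\ge1}X_n$; let $X_{\omega+1}=(\bigsqcup_{n\ge1} X_n,d)$. **Theorem.** $\operatorname{trasdim}(X_{\omega+1})=\omega+1$ and $\operatorname{coasdim}(X_{\omega+1})=\omega+1$. Consequently the "omega conjecture" is false: it is not true that every metric space $X$ with $\omega\le\operatorname{trasdim}X<\infty$ satisfies $\operatorname{trasdim}X=\omega$. -/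

import Mathlib

universe u

section Families

variable {X : Type u} [MetricSpace X]

/-- The family `𝒰` is uniformly bounded: the diameters of its members have a common finite
bound. -/
def UniformlyBounded (𝒰 : Set (Set X)) : Prop :=
  ∃ R : ℝ, 0 < R ∧ ∀ U ∈ 𝒰, ∀ x ∈ U, ∀ y ∈ U, dist x y ≤ R

/-- The family `𝒰` is `r`-disjoint: `inf {d(x, y) | x ∈ U, y ∈ V} ≥ r` for all distinct members
`U`, `V` of `𝒰`. -/
def RDisjoint (r : ℝ) (𝒰 : Set (Set X)) : Prop :=
  ∀ U ∈ 𝒰, ∀ V ∈ 𝒰, U ≠ V → ∀ x ∈ U, ∀ y ∈ V, r ≤ dist x y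

end Families

section TransfiniteAsymptoticDimension

/-- The set `M^σ = {τ | τ finite nonempty, τ ∪ σ ∈ M, τ ∩ σ = ∅}`; here `ℕ+ = {1, 2, …}`. -/
def finResidual (M : Set (Finset ℕ+)) (σ : Finset ℕ+) : Set (Finset ℕ+) :=
  {τ | τ.Nonempty ∧ τ ∪ σ ∈ M ∧ τ ∩ σ = ∅}

/-- `Ord M ≤ α`. For `α = 0` this says that `M` is empty; for `α > 0` it says that for every `a`
there is `β < α` with `Ord M^{a} ≤ β`, that is, `Ord M^{a} < α` (which holds automatically
if `M` is empty). -/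
def FinOrdLE (M : Set (Finset ℕ+)) (α : Ordinal.{0}) : Prop :=
  M = ∅ ∨ ∀ a : ℕ+, ∃ β : Ordinal.{0}, ∃ _ : β < α, FinOrdLE (finResidual M {a}) β
termination_by α

open Classical in
/-- The ordinal number `Ord M`: the least ordinal `α` with `Ord M ≤ α`, and `∞ = ⊤` if there is none. -/
noncomputable def finOrd (M : Set (Finset ℕ+)) : WithTop Ordinal.{0} :=
  if ∃ α, FinOrdLE M α then ((sInf {α | FinOrdLE M α} : Ordinal.{0}) : WithTop Ordinal.{0}) else ⊤

/-- The collection `A(X, d)` of all finite nonempty `σ ⊆ {1, 2, …}` for which there are no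
uniformly bounded families `𝒰 i`, `i ∈ σ`, with `𝒰 i` being `i`-disjoint and all of them
together covering `X`. -/
def obstructionSet (X : Type u) [MetricSpace X] : Set (Finset ℕ+) :=
  {σ | σ.Nonempty ∧ ¬ ∃ 𝒰 : ℕ+ → Set (Set X),
    (∀ i ∈ σ, UniformlyBounded (𝒰 i) ∧ RDisjoint (i : ℝ) (𝒰 i)) ∧
    (⋃ i ∈ σ, ⋃₀ 𝒰 i) = Set.univ}

/-- The transfinite asymptotic dimension of a metric space. -/
noncomputable def trasdim (X : Type u) [MetricSpace X] : WithTop Ordinal.{0} :=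
  finOrd (obstructionSet X)

end TransfiniteAsymptoticDimension

section ComplementaryFiniteAsymptoticDimension

variable {X : Type u} [MetricSpace X]

/-- `coasdim A ≤ γ` for an ordinal `γ` and a subspace `A` of `X`. Writing `γ = l + n` with `l`
zero or a limit ordinal and `n` a natural number, it says that for every `r > 0` there are
`r`-disjoint uniformly bounded families `𝒰 0, …, 𝒰 n` of subsets of `A` such that the complement
`B` of their union in `A` has `coasdim B < l`, i.e. `B` is empty (`coasdim B = -1`) or
`coasdim B ≤ β` for some ordinal `β < l`. -/
def CoasdimLE (A : Set X) (γ : Ordinal.{u}) : Prop :=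
  ∃ (l : Ordinal.{u}) (n : ℕ) (_ : γ = l + n), (l = 0 ∨ Order.IsSuccLimit l) ∧
    ∀ r : ℝ, 0 < r → ∃ 𝒰 : Fin (n + 1) → Set (Set X),
      (∀ i, UniformlyBounded (𝒰 i) ∧ RDisjoint r (𝒰 i) ∧ ∀ U ∈ 𝒰 i, U ⊆ A) ∧
      (A \ (⋃ i, ⋃₀ 𝒰 i) = ∅ ∨
        ∃ β : Ordinal.{u}, ∃ _ : β < l, CoasdimLE (A \ (⋃ i, ⋃₀ 𝒰 i)) β)
termination_by γ
decreasing_by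
  subst_vars
  exact lt_of_lt_of_le (by assumption) (le_add_of_nonneg_right (by simp))

open Classical in
/-- The complementary-finite asymptotic dimension of a metric space: `-1 = ⊥` if the space is
empty, otherwise the least ordinal `γ` with `coasdim X ≤ γ`, and `∞ = ⊤` if there is none. -/
noncomputable def coasdim (X : Type u) [MetricSpace X] : WithBot (WithTop Ordinal.{u}) :=
  if IsEmpty X then ⊥
  else if ∃ γ, CoasdimLE (Set.univ : Set X) γ then
    (((sInf {γ | CoasdimLE (Set.univ : Set X) γ} : Ordinal.{u}) : WithTop Ordinal.{u}) :
      WithBot (WithTop Ordinal.{u}))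
  else ⊤

end ComplementaryFiniteAsymptoticDimension

section TheSpace

/-- `X_n ⊆ ℝⁿ`: the union of the lines parallel to a coordinate axis through the points of the
lattice `(nℤ)ⁿ`. -/
def grid (n : ℕ+) : Set (Fin n → ℝ) :=
  {x | ∃ i, ∀ j, j ≠ i → ∃ k : ℤ, x j = (n : ℝ) * k}

/-- The underlying set of `X_{ω+1}`: the disjoint union of the `X_n`, `n ≥ 1`. -/
def XOmegaAddOne : Type := Σ n : ℕ+, grid n

namespace XOmegaAddOne

/-- The sequence `a' = (a₁, …, a_l, 0, 0, …)` of a point `a = (a₁, …, a_l) ∈ X_l`. -/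
def extend (a : XOmegaAddOne) (i : ℕ) : ℝ :=
  if h : i < (a.1 : ℕ) then (a.2 : Fin a.1 → ℝ) ⟨i, h⟩ else 0

/-- The maximum distance of finitely supported real sequences. -/
noncomputable def dMax (x y : ℕ → ℝ) : ℝ := ⨆ i, |x i - y i|

/-- The constant `c = l + (l + 1) + ⋯ + (k - 1)`, where `l ≤ k` are the two given indices in
increasing order; it is `0` if they agree. -/
noncomputable def gap (p q : ℕ) : ℝ := ∑ i ∈ Finset.Ico (min p q) (max p q), (i : ℝ)

theorem bddAbove_extend (a b : XOmegaAddOne) :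
    BddAbove (Set.range fun i => |a.extend i - b.extend i|) := by
  apply Set.Finite.bddAbove
  apply ((Set.finite_Iio (max (a.1 : ℕ) b.1)).image
    (fun i => |a.extend i - b.extend i|) |>.insert 0).subset
  rintro _ ⟨i, rfl⟩
  by_cases h : i < max (a.1 : ℕ) b.1
  · exact Or.inr ⟨i, h, rfl⟩
  · left
    simp only [lt_max_iff, not_or] at h
    simp [extend, h.1, h.2]

theorem abs_le_dMax (a b : XOmegaAddOne) (i : ℕ) :
    |a.extend i - b.extend i| ≤ dMax a.extend b.extend :=
  le_ciSup (bddAbove_extend a b) i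

theorem gap_eq_abs (p q : ℕ) :
    gap p q = |(∑ i ∈ Finset.range p, (i : ℝ)) - ∑ i ∈ Finset.range q, (i : ℝ)| := by
  have key : ∀ p q : ℕ, p ≤ q → (∑ i ∈ Finset.Ico p q, (i : ℝ)) =
      |(∑ i ∈ Finset.range p, (i : ℝ)) - ∑ i ∈ Finset.range q, (i : ℝ)| := by
    intro p q h
    have h1 := Finset.sum_Ico_eq_sub (fun i : ℕ => (i : ℝ)) h
    have h2 : 0 ≤ ∑ i ∈ Finset.Ico p q, (i : ℝ) := Finset.sum_nonneg fun i _ => Nat.cast_nonneg i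
    rw [abs_sub_comm, ← h1, abs_of_nonneg h2]
  rcases le_total p q with h | h
  · simpa [gap, h] using key p q h
  · rw [abs_sub_comm]
    simpa [gap, h] using key q p h

theorem gap_pos {p q : ℕ} (hp : 0 < p) (hq : 0 < q) (h : p ≠ q) : 0 < gap p q := by
  apply Finset.sum_pos
  · intro i hi
    have := (Finset.mem_Ico.1 hi).1
    exact_mod_cast lt_of_lt_of_le (lt_min hp hq) this
  · rw [Finset.nonempty_Ico]
    exact min_lt_max.2 h

/-- The metric `d(a, b) = max {d_max(a', b'), c}`. -/
noncomputable instance : MetricSpace XOmegaAddOne where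
  dist a b := max (dMax a.extend b.extend) (gap a.1 b.1)
  dist_self a := by simp [dMax, gap]
  dist_comm a b := by simp only [dMax, gap, abs_sub_comm, min_comm, max_comm]
  dist_triangle a b c := by
    apply max_le
    · refine le_trans (ciSup_le fun i => ?_) (add_le_add (le_max_left _ _) (le_max_left _ _))
      exact (abs_sub_le _ (b.extend i) _).trans
        (add_le_add (abs_le_dMax a b i) (abs_le_dMax b c i))
    · refine le_trans ?_ (add_le_add (le_max_right _ _) (le_max_right _ _))
      simp only [gap_eq_abs]
      exact abs_sub_le _ _ _
  eq_of_dist_eq_zero := by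
    intro a b h
    have hd : dMax a.extend b.extend ≤ 0 := h ▸ le_max_left _ _
    have hg : gap a.1 b.1 ≤ 0 := h ▸ le_max_right _ _
    have hc : ∀ i, a.extend i = b.extend i := fun i => by
      have := abs_nonpos_iff.1 ((abs_le_dMax a b i).trans hd)
      linarith
    obtain ⟨p, x, hx⟩ := a
    obtain ⟨q, y, hy⟩ := b
    have hpq : p = q := by
      by_contra hne
      exact absurd hg (not_le.2 (gap_pos p.pos q.pos fun e => hne (PNat.coe_injective e)))
    subst hpq
    have hxy : x = y := by
      funext i
      simpa [extend] using hc i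
    subst hxy
    rfl

end XOmegaAddOne

end TheSpace

/-! Upper bounds. Let `M ≥ 4r`. Every `X_m` with `m ≥ M` has a mesh `s` between `2r` and `4r` such
that `m` is an even multiple of `s`. Rounding coordinates to multiples of `s` sends each point to an
integer vector with at most one odd entry. The points with no odd entry and those with one odd
entry, split by rounding vector, form two uniformly bounded `r`-disjoint families covering all these
`X_m` at once (`exists_rDisjoint_cover_high`), since `X_p` and `X_q` are at distance at least `min p
q` apart. The finitely many remaining `X_m` are covered at every scale by a number of families that
depends only on `M` (`exists_rDisjoint_cover_low`). Hence two indices `a`, `b` leave only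
obstructions of bounded size, so both dimensions are at most `ω + 1`.

Lower bounds. `X_n` is not covered by one bounded `1`-disjoint family and `n - 1` bounded
`(3n+1)`-disjoint ones (`not_covered`). Given such a cover, color each cube of `ℤⁿ` by a widely
disjoint family that meets its edges. If there is none, the `1`-disjoint family contains all edges
of the cube and, the edges being connected, a single member contains all vertices. Neighboring cubes
of equal color then select the same member, so `n` colors would have bounded components,
contradicting the Lebesgue covering theorem (`not_bounded_coloring`). Consequently a single
`1`-disjoint family never leaves a remainder of finite asymptotic dimension, which excludes every
value up to `ω`.

The covering theorem follows from a discrete Poincaré–Miranda theorem, proved by mod 2 cohomology: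
the sum of the cup product of the `δf_i` over all Kuhn simplices does not change when one separating
function is replaced by another, and it is `1` for half spaces. -/

/-! ### Mod 2 cochains, Poincaré–Miranda and the Lebesgue covering theorem -/

section PoincareMiranda

variable {V : Type*}

/-- The simplicial coboundary mod 2 of a function of `n` points. -/
def coboundary {n : ℕ} (ω : (Fin n → V) → ZMod 2) (x : Fin (n + 1) → V) : ZMod 2 :=
  ∑ j : Fin (n + 1), ω (x ∘ j.succAbove)

/-- The cup product of the coboundaries of `n` functions. -/
def cupProduct {n : ℕ} (f : Fin n → V → ZMod 2) (x : Fin (n + 1) → V) : ZMod 2 :=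
  ∏ j : Fin n, (f j (x j.castSucc) + f j (x j.succ))

/-- The cup product of the coboundary of `f` with `ω`. -/
def edgeMul {n : ℕ} (f : V → ZMod 2) (ω : (Fin (n + 1) → V) → ZMod 2) (x : Fin (n + 2) → V) :
    ZMod 2 :=
  (f (x 0) + f (x 1)) * ω (x ∘ Fin.succ)

theorem cupProduct_succ {n : ℕ} (f : Fin (n + 1) → V → ZMod 2) (x : Fin (n + 2) → V) :
    cupProduct f x = edgeMul (f 0) (cupProduct fun j => f j.succ) x := by
  simp [cupProduct, edgeMul, Fin.prod_univ_succ]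

theorem zmod_two_add_self (a : ZMod 2) : a + a = 0 := CharTwo.add_self_eq_zero a

/-- The Leibniz rule for `δf ∪ ω`, where `δδf = 0`: the faces omitting vertices 0 and 1 together
give `f (x 0) + f (x 1)`, as `f (x 2)` occurs twice. -/
theorem coboundary_edgeMul {n : ℕ} (f : V → ZMod 2) (ω : (Fin (n + 1) → V) → ZMod 2)
    (x : Fin (n + 3) → V) :
    coboundary (edgeMul f ω) x = edgeMul f (coboundary ω) x := by
  have e1 : (x ∘ Fin.succAbove 1) ∘ Fin.succ = (x ∘ Fin.succ) ∘ Fin.succAbove 0 := by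
    funext j
    have : (1 : Fin (n + 3)) = Fin.succ 0 := rfl
    simp only [Function.comp, this, Fin.succ_succAbove_succ]
  have e2 : ∀ i : Fin (n + 1), (x ∘ Fin.succAbove i.succ.succ) ∘ Fin.succ =
      (x ∘ Fin.succ) ∘ Fin.succAbove i.succ := by
    intro i; funext j
    simp only [Function.comp, Fin.succ_succAbove_succ]
  have a1 : ∀ i : Fin (n + 1), (Fin.succAbove i.succ.succ 1 : Fin (n + 3)) = 1 := by
    intro i
    have : (1 : Fin (n + 2)) = Fin.succ 0 := rfl
    rw [this, Fin.succ_succAbove_succ]; simp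
  have a2 : (Fin.succAbove 1 1 : Fin (n + 3)) = 2 := by
    have h1 : (1 : Fin (n + 2)) = Fin.succ 0 := rfl
    have h2 : (1 : Fin (n + 3)) = Fin.succ 0 := rfl
    have h3 : (2 : Fin (n + 3)) = Fin.succ (Fin.succ 0) := rfl
    rw [h2, h1, Fin.succ_succAbove_succ, h3]; simp
  have a3 : (Fin.succ 1 : Fin (n + 3)) = 2 := rfl
  simp only [coboundary, edgeMul]
  rw [Fin.sum_univ_succ, Fin.sum_univ_succ]
  conv_rhs => rw [Fin.sum_univ_succ]
  simp only [Fin.succ_zero_eq_one, e1, e2, Function.comp_apply, a1, a2, a3, mul_add,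
    Finset.mul_sum, Fin.succAbove_zero, Fin.succ_succAbove_zero, Fin.one_succAbove_zero]
  rw [← add_assoc, ← add_mul]
  congr 2
  linear_combination zmod_two_add_self (f (x 2))

theorem coboundary_cupProduct {n : ℕ} (f : Fin n → V → ZMod 2) (x : Fin (n + 2) → V) :
    coboundary (cupProduct f) x = 0 := by
  induction n with
  | zero =>
    simp only [coboundary, cupProduct, Finset.univ_eq_empty, Finset.prod_empty]
    decide
  | succ n ih =>
    have : cupProduct f = edgeMul (f 0) (cupProduct fun j => f j.succ) :=
      funext (cupProduct_succ f)
    rw [this, coboundary_edgeMul]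
    simp [edgeMul, ih]

theorem exists_ne_of_cupProduct_ne_zero {n : ℕ} {f : Fin n → V → ZMod 2} {x : Fin (n + 1) → V}
    (h : cupProduct f x ≠ 0) (j : Fin n) : ∃ m m', f j (x m) ≠ f j (x m') := by
  refine ⟨j.castSucc, j.succ, fun e => h ?_⟩
  refine Finset.prod_eq_zero (Finset.mem_univ j) ?_
  rw [e, zmod_two_add_self]

/-- The primitive is the cup product with `δf_i` replaced by the 0-cochain `f_i + g`. The last
clause localizes its support, so that sums over the infinite triangulation are finite. -/
theorem exists_coboundary_eq {n : ℕ} (f : Fin n → V → ZMod 2) (i : Fin n) (g : V → ZMod 2) :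
    ∃ ω : (Fin n → V) → ZMod 2,
      (∀ x, coboundary ω x = cupProduct f x + cupProduct (Function.update f i g) x) ∧
      ∀ y, ω y ≠ 0 → (∃ m, f i (y m) ≠ g (y m)) ∧
        ∀ j, j ≠ i → ∃ m m', f j (y m) ≠ f j (y m') := by
  induction n with
  | zero => exact i.elim0
  | succ n ih =>
    refine Fin.cases ?_ (fun i' => ?_) i
    · refine ⟨fun y => (f 0 (y 0) + g (y 0)) * cupProduct (fun j => f j.succ) y, fun x => ?_,
        fun y hy => ⟨⟨0, fun e => hy ?_⟩, fun j hj => ?_⟩⟩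
      · have h := coboundary_cupProduct (fun j => f (Fin.succ j)) x
        rw [cupProduct_succ, cupProduct_succ]
        simp only [coboundary, edgeMul] at h ⊢
        rw [Fin.sum_univ_succ] at h ⊢
        simp only [Function.comp_apply, Fin.succAbove_zero, Fin.succ_succAbove_zero,
          Function.update_self, ← Finset.mul_sum, Fin.succ_zero_eq_one] at h ⊢
        have hu : (fun j : Fin n => Function.update f 0 g j.succ) = fun j => f j.succ := by
          funext j; simp
        rw [hu]
        have h' := zmod_two_add_self (cupProduct (fun j => f (Fin.succ j)) (x ∘ Fin.succ))
        linear_combination (f 0 (x 0) + g (x 0)) * h - (f 0 (x 0) + g (x 0)) * h'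
      · simp only [e, zmod_two_add_self, zero_mul]
      · obtain ⟨j', rfl⟩ := Fin.exists_succ_eq.2 hj
        exact exists_ne_of_cupProduct_ne_zero (right_ne_zero_of_mul hy) j'
    · obtain ⟨ω, h1, h2⟩ := ih (fun j => f j.succ) i'
      cases n with
      | zero => exact i'.elim0
      | succ n =>
        refine ⟨edgeMul (f 0) ω, fun x => ?_, fun y hy => ?_⟩
        · rw [coboundary_edgeMul, cupProduct_succ, cupProduct_succ]
          have hu : (fun j : Fin (n + 1) => Function.update f i'.succ g j.succ) =
              Function.update (fun j => f j.succ) i' g := by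
            funext j
            by_cases h : j = i'
            · subst h; simp
            · simp [h]
          have h0 : Function.update f i'.succ g 0 = f 0 := by
            rw [Function.update_of_ne (Fin.succ_ne_zero i').symm]
          rw [hu, h0]
          simp only [edgeMul, h1, mul_add]
        · obtain ⟨⟨m, hm⟩, h4⟩ := h2 _ (right_ne_zero_of_mul hy)
          refine ⟨⟨m.succ, hm⟩, fun j => ?_⟩
          refine Fin.cases (fun _ => ⟨0, 1, fun e => hy ?_⟩) (fun j' hj => ?_) j
          · simp [edgeMul, e, zmod_two_add_self]
          · obtain ⟨a, b, hab⟩ := h4 j' fun e => hj (by rw [e])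
            exact ⟨a.succ, b.succ, hab⟩

/-- The vertices of the simplex of the Kuhn triangulation of `ℤⁿ` that starts at `z` and moves
in the direction `i` at time `ρ i`. -/
def kuhnChain {n : ℕ} (z : Fin n → ℤ) (ρ : Equiv.Perm (Fin n)) (j : Fin (n + 1)) : Fin n → ℤ :=
  fun i => z i + if (ρ i : ℕ) < j then 1 else 0

theorem kuhnChain_apply {n : ℕ} (z : Fin n → ℤ) (ρ : Equiv.Perm (Fin n)) {j : Fin (n + 1)}
    {i : Fin n} {a b : ℕ} (ha : (ρ i : ℕ) = a) (hb : (j : ℕ) = b) :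
    kuhnChain z ρ j i = z i + if a < b then 1 else 0 := by
  subst ha hb; rfl

theorem kuhnChain_mem {n : ℕ} (z : Fin n → ℤ) (ρ : Equiv.Perm (Fin n)) (j : Fin (n + 1))
    (i : Fin n) : z i ≤ kuhnChain z ρ j i ∧ kuhnChain z ρ j i ≤ z i + 1 := by
  unfold kuhnChain; split_ifs <;> omega

/-- The face opposite the first vertex is the face opposite the last vertex of the simplex that
starts one move later and performs the skipped move at the end. -/
theorem kuhnChain_comp_succ {n : ℕ} (z : Fin (n + 1) → ℤ) (ρ : Equiv.Perm (Fin (n + 1))) :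
    kuhnChain z ρ ∘ Fin.succ =
      kuhnChain (z + fun i => if ρ i = 0 then 1 else 0) (ρ.trans (finRotate (n + 1)).symm) ∘
        Fin.castSucc := by
  funext j i
  obtain ⟨q, hq⟩ : ∃ q, finRotate (n + 1) q = ρ i := (finRotate (n + 1)).surjective _
  have hq' : (((ρ.trans (finRotate (n + 1)).symm) i : Fin (n + 1)) : ℕ) = q := by
    rw [Equiv.trans_apply, ← hq, Equiv.symm_apply_apply]
  rw [Function.comp_apply, Function.comp_apply, kuhnChain_apply z ρ rfl (Fin.val_succ j),
    kuhnChain_apply _ _ hq' (Fin.val_castSucc j), ← hq, Pi.add_apply, ← hq, add_assoc]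
  congr 1
  have hj := j.is_lt
  rcases eq_or_ne q (Fin.last n) with rfl | hne
  · rw [finRotate_last]
    simp
    omega
  · have hv : ((finRotate (n + 1) q : Fin (n + 1)) : ℕ) = q + 1 := coe_finRotate_of_ne_last hne
    have h0 : finRotate (n + 1) q ≠ 0 := fun e => by rw [e] at hv; simp at hv
    rw [if_neg h0, hv]
    simp

theorem kuhnChain_comp_swap {n : ℕ} (z : Fin (n + 1) → ℤ) (ρ : Equiv.Perm (Fin (n + 1)))
    (p : Fin n) :
    kuhnChain z (ρ.trans (Equiv.swap p.castSucc p.succ)) ∘ Fin.succAbove p.succ.castSucc =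
      kuhnChain z ρ ∘ Fin.succAbove p.succ.castSucc := by
  funext j i
  have hne : ((Fin.succAbove p.succ.castSucc j : Fin (n + 2)) : ℕ) ≠ p + 1 := fun h =>
    Fin.succAbove_ne p.succ.castSucc j (Fin.ext (by simpa using h))
  rw [Function.comp_apply, Function.comp_apply,
    kuhnChain_apply z (ρ.trans (Equiv.swap p.castSucc p.succ))
      (congrArg Fin.val (Equiv.trans_apply ρ _ i)) rfl, kuhnChain_apply z ρ rfl rfl]
  generalize ((Fin.succAbove p.succ.castSucc j : Fin (n + 2)) : ℕ) = J at hne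
  congr 1
  rcases eq_or_ne (ρ i) p.castSucc with h | h
  · rw [h, Equiv.swap_apply_left]
    simp only [Fin.val_succ, Fin.val_castSucc]
    split_ifs <;> omega
  · rcases eq_or_ne (ρ i) p.succ with h' | h'
    · rw [h', Equiv.swap_apply_right]
      simp only [Fin.val_succ, Fin.val_castSucc]
      split_ifs <;> omega
    · rw [Equiv.swap_apply_of_ne_of_ne h h']

/-- Each facet lies in two simplices. Inner facets cancel in pairs by exchanging two consecutive
moves; first and last facets cancel by the shift in `kuhnChain_comp_succ`. -/
theorem finsum_coboundary_kuhnChain {n : ℕ} (ω : (Fin (n + 1) → Fin (n + 1) → ℤ) → ZMod 2)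
    (hω : ∀ ρ j, (Function.support fun z => ω (kuhnChain z ρ ∘ Fin.succAbove j)).Finite) :
    ∑ᶠ z, ∑ ρ, coboundary ω (kuhnChain z ρ) = 0 := by
  simp only [coboundary]
  have h1 : ∀ z, ∑ ρ, ∑ j, ω (kuhnChain z ρ ∘ Fin.succAbove j) =
      ∑ ρ, ω (kuhnChain z ρ ∘ Fin.succ) + ∑ ρ, ω (kuhnChain z ρ ∘ Fin.castSucc) := by
    intro z
    rw [Finset.sum_comm, Fin.sum_univ_succ, Fin.sum_univ_castSucc]
    have : ∀ p : Fin n, ∑ ρ, ω (kuhnChain z ρ ∘ Fin.succAbove p.castSucc.succ) = 0 := by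
      intro p
      rw [← Fin.castSucc_succ]
      refine Finset.sum_involution
        (fun ρ _ => ρ.trans (Equiv.swap p.castSucc p.succ)) ?_ ?_ ?_ ?_
      · intro ρ _
        rw [kuhnChain_comp_swap, zmod_two_add_self]
      · intro ρ _ _ e
        have := congrArg (fun τ : Equiv.Perm (Fin (n + 1)) => τ (ρ.symm p.castSucc)) e
        simp [Fin.ext_iff] at this
      · intros; exact Finset.mem_univ _
      · intro ρ _
        ext i
        simp
    rw [Finset.sum_eq_zero fun p _ => this p, zero_add]
    simp only [Fin.succAbove_zero, Fin.succ_last, Fin.succAbove_last]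
  simp only [h1]
  have hs : ∀ ρ, (Function.support fun z => ω (kuhnChain z ρ ∘ Fin.succ)).Finite := by
    intro ρ
    simpa using hω ρ 0
  have hc : ∀ ρ, (Function.support fun z => ω (kuhnChain z ρ ∘ Fin.castSucc)).Finite := by
    intro ρ
    simpa using hω ρ (Fin.last _)
  have fin_sum : ∀ F : (Fin (n + 1) → ℤ) → Equiv.Perm (Fin (n + 1)) → ZMod 2,
      (∀ ρ, (Function.support fun z => F z ρ).Finite) →
      (Function.support fun z => ∑ ρ, F z ρ).Finite := by
    intro F hF
    refine (Set.finite_iUnion hF).subset fun z hz => ?_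
    obtain ⟨ρ, -, hρ⟩ := Finset.exists_ne_zero_of_sum_ne_zero hz
    exact Set.mem_iUnion.2 ⟨ρ, hρ⟩
  rw [finsum_add_distrib (fin_sum _ hs) (fin_sum _ hc), finsum_sum_comm _ _ fun ρ _ => hs ρ,
    finsum_sum_comm _ _ fun ρ _ => hc ρ]
  have h2 : ∀ ρ : Equiv.Perm (Fin (n + 1)), ∑ᶠ z, ω (kuhnChain z ρ ∘ Fin.succ) =
      ∑ᶠ z, ω (kuhnChain z (ρ.trans (finRotate (n + 1)).symm) ∘ Fin.castSucc) := by
    intro ρ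
    simp only [kuhnChain_comp_succ]
    exact finsum_comp_equiv (Equiv.addRight fun i => if ρ i = 0 then (1 : ℤ) else 0)
      (f := fun z => ω (kuhnChain z (ρ.trans (finRotate (n + 1)).symm) ∘ Fin.castSucc))
  simp only [h2]
  have h3 := Equiv.sum_comp (Equiv.mulLeft (finRotate (n + 1)).symm)
    fun ρ : Equiv.Perm (Fin (n + 1)) => ∑ᶠ z, ω (kuhnChain z ρ ∘ Fin.castSucc)
  have h4 : ∀ ρ : Equiv.Perm (Fin (n + 1)),
      Equiv.mulLeft (finRotate (n + 1)).symm ρ = ρ.trans (finRotate (n + 1)).symm :=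
    fun ρ => rfl
  simp only [h4] at h3
  rw [h3, zmod_two_add_self]

/-- `f` is `1` on the half space `x i ≤ 0` and `0` on the half space `N ≤ x i`. -/
def Separates {n : ℕ} (N : ℤ) (i : Fin n) (f : (Fin n → ℤ) → ZMod 2) : Prop :=
  (∀ x, x i ≤ 0 → f x = 1) ∧ ∀ x, N ≤ x i → f x = 0

theorem Separates.mem_Icc {n : ℕ} {N : ℤ} {i : Fin n} {f g : (Fin n → ℤ) → ZMod 2}
    (hf : Separates N i f) (hg : Separates N i g) {z x y : Fin n → ℤ}
    (hx : z i ≤ x i ∧ x i ≤ z i + 1) (hy : z i ≤ y i ∧ y i ≤ z i + 1) (h : f x ≠ g y) :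
    -1 ≤ z i ∧ z i ≤ N := by
  constructor
  · by_contra hz
    exact h (by rw [hf.1 x (by omega), hg.1 y (by omega)])
  · by_contra hz
    exact h (by rw [hf.2 x (by omega), hg.2 y (by omega)])

theorem finite_support_of_forall_mem_Icc {n : ℕ} {N : ℤ} (F : (Fin n → ℤ) → ZMod 2)
    (h : ∀ z, F z ≠ 0 → ∀ i, -1 ≤ z i ∧ z i ≤ N) : (Function.support F).Finite :=
  (Set.finite_Icc (fun _ => -1 : Fin n → ℤ) (fun _ => N)).subset fun z hz =>
    ⟨fun i => (h z hz i).1, fun i => (h z hz i).2⟩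

theorem finite_support_cupProduct {n : ℕ} {N : ℤ} {f : Fin n → (Fin n → ℤ) → ZMod 2}
    (hf : ∀ i, Separates N i (f i)) :
    (Function.support fun z => ∑ ρ, cupProduct f (kuhnChain z ρ)).Finite := by
  refine finite_support_of_forall_mem_Icc (N := N) _ fun z hz i => ?_
  obtain ⟨ρ, -, hρ⟩ := Finset.exists_ne_zero_of_sum_ne_zero hz
  obtain ⟨m, m', h⟩ := exists_ne_of_cupProduct_ne_zero hρ i
  exact (hf i).mem_Icc (hf i) (kuhnChain_mem _ _ _ _) (kuhnChain_mem _ _ _ _) h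

/-- The two cup products differ by a coboundary. Its primitive has finite support because any two
functions separating direction `p` agree outside `0 < x p < N`. -/
theorem finsum_cupProduct_update {n : ℕ} {N : ℤ} {f : Fin n → (Fin n → ℤ) → ZMod 2}
    (hf : ∀ i, Separates N i (f i)) (i : Fin n) {g : (Fin n → ℤ) → ZMod 2}
    (hg : Separates N i g) :
    ∑ᶠ z, ∑ ρ, cupProduct f (kuhnChain z ρ) =
      ∑ᶠ z, ∑ ρ, cupProduct (Function.update f i g) (kuhnChain z ρ) := by
  cases n with
  | zero => exact i.elim0
  | succ n =>
    have hf' : ∀ j, Separates N j (Function.update f i g j) := by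
      intro j
      by_cases h : j = i
      · subst h; simpa using hg
      · simpa [h] using hf j
    obtain ⟨ω, h1, h2⟩ := exists_coboundary_eq f i g
    have h3 := finsum_coboundary_kuhnChain ω fun ρ j => by
      refine finite_support_of_forall_mem_Icc (N := N) _ fun z hz p => ?_
      obtain ⟨⟨m, hm⟩, h4⟩ := h2 _ hz
      by_cases hp : p = i
      · subst hp
        exact (hf p).mem_Icc hg (kuhnChain_mem _ _ _ _) (kuhnChain_mem _ _ _ _) hm
      · obtain ⟨a, b, hab⟩ := h4 p hp
        exact (hf p).mem_Icc (hf p) (kuhnChain_mem _ _ _ _) (kuhnChain_mem _ _ _ _) hab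
    simp only [h1, Finset.sum_add_distrib] at h3
    rw [finsum_add_distrib (finite_support_cupProduct hf) (finite_support_cupProduct hf')] at h3
    exact CharTwo.add_eq_zero.1 h3

/-- Only the simplex starting at the origin with the identity permutation contributes: its `i`-th
edge must be the one that crosses the `i`-th half space boundary. -/
theorem finsum_cupProduct_halfSpace (n : ℕ) :
    ∑ᶠ z, ∑ ρ, cupProduct (fun (i : Fin n) (x : Fin n → ℤ) => if x i ≤ 0 then (1 : ZMod 2) else 0)
      (kuhnChain z ρ) = 1 := by
  have key : ∀ z ρ, cupProduct
      (fun (i : Fin n) (x : Fin n → ℤ) => if x i ≤ 0 then (1 : ZMod 2) else 0)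
      (kuhnChain z ρ) ≠ 0 → z = 0 ∧ ρ = 1 := by
    intro z ρ h
    have h' : ∀ i, z i = 0 ∧ ρ i = i := by
      intro i
      have hi := (Finset.prod_ne_zero_iff.1 h) i (Finset.mem_univ i)
      simp only [kuhnChain, Fin.val_castSucc, Fin.val_succ] at hi
      by_cases h1 : (ρ i : ℕ) < i
      · simp [h1, Nat.lt_succ_of_lt h1, zmod_two_add_self] at hi
      · by_cases h2 : (ρ i : ℕ) < i + 1
        · refine ⟨?_, Fin.ext (by omega)⟩
          simp only [h1, h2, if_true, if_false] at hi
          by_contra hz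
          apply hi
          split_ifs <;> first | omega | rfl
        · simp [h1, h2, zmod_two_add_self] at hi
    exact ⟨funext fun i => (h' i).1, Equiv.ext fun i => (h' i).2⟩
  rw [finsum_eq_single _ 0, Finset.sum_eq_single 1]
  · refine Finset.prod_eq_one fun i _ => ?_
    simp [kuhnChain]
  · intro ρ _ hρ
    by_contra h
    exact hρ (key _ _ h).2
  · simp
  · intro z hz
    refine Finset.sum_eq_zero fun ρ _ => ?_
    by_contra h
    exact hz (key _ _ h).1

/-- A discrete Poincaré–Miranda theorem. -/
theorem exists_cube_forall_ne {n : ℕ} {N : ℤ} (hN : 0 < N) {f : Fin n → (Fin n → ℤ) → ZMod 2}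
    (hf : ∀ i, Separates N i (f i)) :
    ∃ z : Fin n → ℤ, ∀ i, ∃ x y : Fin n → ℤ, (∀ j, z j ≤ x j ∧ x j ≤ z j + 1) ∧
      (∀ j, z j ≤ y j ∧ y j ≤ z j + 1) ∧ f i x ≠ f i y := by
  set g : Fin n → (Fin n → ℤ) → ZMod 2 := fun i x => if x i ≤ 0 then 1 else 0 with hgdef
  have hg : ∀ i, Separates N i (g i) := fun i =>
    ⟨fun x hx => if_pos hx, fun x hx => if_neg (by omega)⟩
  have h : ∀ s : Finset (Fin n), ∑ᶠ z, ∑ ρ, cupProduct f (kuhnChain z ρ) =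
      ∑ᶠ z, ∑ ρ, cupProduct (s.piecewise g f) (kuhnChain z ρ) := by
    intro s
    induction s using Finset.induction_on with
    | empty => simp
    | insert i s _ ih =>
      rw [ih, Finset.piecewise_insert]
      refine finsum_cupProduct_update (N := N) (fun j => ?_) i (hg i)
      by_cases hj : j ∈ s
      · simpa [hj] using hg j
      · simpa [hj] using hf j
  have h1 := h Finset.univ
  rw [Finset.piecewise_univ, finsum_cupProduct_halfSpace] at h1
  obtain ⟨z, hz⟩ : ∃ z, ∑ ρ, cupProduct f (kuhnChain z ρ) ≠ 0 := by
    by_contra! hc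
    simp [hc] at h1
  obtain ⟨ρ, -, hρ⟩ := Finset.exists_ne_zero_of_sum_ne_zero hz
  refine ⟨z, fun i => ?_⟩
  obtain ⟨m, m', hm⟩ := exists_ne_of_cupProduct_ne_zero hρ i
  exact ⟨_, _, kuhnChain_mem z ρ m, kuhnChain_mem z ρ m', hm⟩

/-- A discrete Lebesgue covering theorem: there is no coloring of `ℤᵏ` with `k` colors all of
whose monochromatic components are uniformly bounded. -/
theorem not_bounded_coloring {k : ℕ} {L : Type*} (color : (Fin k → ℤ) → Fin k)
    (lab : (Fin k → ℤ) → L) (N : ℤ)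
    (hlab : ∀ w w', (∀ j, |w j - w' j| ≤ 2) → color w = color w' → lab w = lab w')
    (hN : ∀ w w', color w = color w' → lab w = lab w' → ∀ j, w j - w' j ≤ N) : False := by
  classical
  -- `E i` is the union of the components of color `i` that reach down to `x i ≤ 1`. Thickening it
  -- by 1 and adding the half space gives `B i`, which stays below `N + 3`.
  let E : Fin k → Set (Fin k → ℤ) := fun i =>
    {w | color w = i ∧ ∃ w', color w' = i ∧ lab w = lab w' ∧ w' i ≤ 1}
  let B : Fin k → Set (Fin k → ℤ) := fun i => {x | x i ≤ 0 ∨ ∃ w ∈ E i, ∀ j, |w j - x j| ≤ 1}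
  have hN0 : 0 ≤ N ∨ k = 0 := by
    rcases Nat.eq_zero_or_pos k with h | h
    · exact Or.inr h
    · left
      simpa using hN 0 0 rfl rfl ⟨0, h⟩
  rcases hN0 with hN0 | rfl
  swap
  · exact (color 0).elim0
  obtain ⟨z, hz⟩ := exists_cube_forall_ne (N := N + 3) (by omega)
    (f := fun i x => if x ∈ B i then 1 else 0) (fun i => by
      refine ⟨fun x hx => if_pos (Or.inl hx), fun x hx => if_neg ?_⟩
      rintro (h | ⟨w, ⟨hw, w', hw', hl, h1⟩, h2⟩)
      · omega
      · have h3 := hN w w' (hw.trans hw'.symm) hl i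
        have h4 := abs_le.1 (h2 i)
        omega)
  -- In its own color, the corner `z` decides the whole cube: if `z ∈ E`, the cube lies in `B`; if
  -- one cube vertex lies in `B`, a point of `E` within 2 of `z`, or the half space, forces `z ∈ E`.
  have key : ∀ x y : Fin k → ℤ, (∀ j, z j ≤ x j ∧ x j ≤ z j + 1) →
      (∀ j, z j ≤ y j ∧ y j ≤ z j + 1) → x ∈ B (color z) → y ∉ B (color z) → False := by
    intro x y hx hy hxB hyB
    have hzE : z ∉ E (color z) := fun h => hyB (Or.inr ⟨z, h, fun j => by
      have := hy j
      rw [abs_le]; omega⟩)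
    rcases hxB with h | ⟨w, ⟨hw, w', hw', hl, h1⟩, h2⟩
    · exact hzE ⟨rfl, z, rfl, rfl, by have := hx (color z); omega⟩
    · refine hzE ⟨rfl, w', hw', ?_, h1⟩
      rw [← hl]
      refine hlab _ _ (fun j => ?_) hw.symm
      have h3 := abs_le.1 (h2 j)
      have h4 := hx j
      rw [abs_le]; omega
  obtain ⟨x, y, hx, hy, hxy⟩ := hz (color z)
  by_cases h1 : x ∈ B (color z) <;> by_cases h2 : y ∈ B (color z)
  · simp [h1, h2] at hxy
  · exact key x y hx hy h1 h2
  · exact key y x hy hx h2 h1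
  · simp [h1, h2] at hxy

end PoincareMiranda

/-! ### The covering obstruction in `X_n` -/

namespace XOmegaAddOne

theorem abs_extend_sub_le_dist (a b : XOmegaAddOne) (i : ℕ) :
    |a.extend i - b.extend i| ≤ dist a b :=
  (abs_le_dMax a b i).trans (le_max_left _ _)

theorem gap_le_dist (a b : XOmegaAddOne) : gap a.1 b.1 ≤ dist a b := le_max_right _ _

theorem dist_le_of_fst_eq {a b : XOmegaAddOne} (h : a.1 = b.1) {c : ℝ}
    (hc : ∀ i, |a.extend i - b.extend i| ≤ c) : dist a b ≤ c := by
  refine max_le (ciSup_le hc) ?_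
  rw [h]
  simpa [gap] using (abs_nonneg _).trans (hc 0)

/-- The point at distance `t` from the lattice point `n v` on the line through `n v` in the
direction `i`. -/
def linePoint (n : ℕ+) (v : Fin n → ℤ) (i : Fin n) (t : ℝ) : XOmegaAddOne :=
  ⟨n, fun j => n * v j + if j = i then t else 0, i, fun j hj => ⟨v j, by simp [hj]⟩⟩

theorem extend_linePoint (n : ℕ+) (v : Fin n → ℤ) (i : Fin n) (t : ℝ) (j : Fin n) :
    (linePoint n v i t).extend j = n * v j + if j = i then t else 0 := by
  unfold extend linePoint
  exact dif_pos j.is_lt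

theorem extend_eq_zero {a : XOmegaAddOne} {i : ℕ} (h : (a.1 : ℕ) ≤ i) : a.extend i = 0 :=
  dif_neg (not_lt.2 h)

theorem dist_le_of_forall_fin {n : ℕ+} {a b : XOmegaAddOne} (ha : a.1 = n) (hb : b.1 = n) {c : ℝ}
    (hc0 : 0 ≤ c) (hc : ∀ i : Fin n, |a.extend i - b.extend i| ≤ c) : dist a b ≤ c := by
  refine dist_le_of_fst_eq (ha.trans hb.symm) fun i => ?_
  by_cases hi : i < n
  · exact hc ⟨i, hi⟩
  · rw [extend_eq_zero (by rw [ha]; omega), extend_eq_zero (by rw [hb]; omega)]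
    simpa using hc0

theorem linePoint_zero (n : ℕ+) (v : Fin n → ℤ) (i i' : Fin n) :
    linePoint n v i 0 = linePoint n v i' 0 := by
  refine dist_le_zero.1 (dist_le_of_forall_fin (n := n) rfl rfl le_rfl fun j => ?_)
  simp [extend_linePoint]

theorem linePoint_self (n : ℕ+) (v : Fin n → ℤ) (i : Fin n) :
    linePoint n v i n = linePoint n (Function.update v i (v i + 1)) i 0 := by
  refine dist_le_zero.1 (dist_le_of_forall_fin (n := n) rfl rfl le_rfl fun j => ?_)
  rw [extend_linePoint, extend_linePoint]
  by_cases h : j = i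
  · subst h; simp; ring_nf
  · simp [h]

/-- The edges of `X_n` that start at a vertex of the cube `n (z + [0, 1]ⁿ)`. -/
def cubeEdges (n : ℕ+) (z : Fin n → ℤ) : Set XOmegaAddOne :=
  {x | ∃ v i t, (∀ j, z j ≤ v j ∧ v j ≤ z j + 1) ∧ 0 ≤ t ∧ t ≤ (n : ℝ) ∧ x = linePoint n v i t}

theorem fst_of_mem_cubeEdges {n : ℕ+} {z : Fin n → ℤ} {x : XOmegaAddOne}
    (hx : x ∈ cubeEdges n z) : x.1 = n := by
  obtain ⟨v, i, t, -, -, -, rfl⟩ := hx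
  rfl

theorem extend_of_mem_cubeEdges {n : ℕ+} {z : Fin n → ℤ} {x : XOmegaAddOne}
    (hx : x ∈ cubeEdges n z) (j : Fin n) :
    (n : ℝ) * z j ≤ x.extend j ∧ x.extend j ≤ n * z j + 2 * n := by
  obtain ⟨v, i, t, hv, h0, h1, rfl⟩ := hx
  rw [extend_linePoint]
  have hn : (0 : ℝ) < n := by exact_mod_cast n.pos
  have h2 : (z j : ℝ) ≤ v j := by exact_mod_cast (hv j).1
  have h3 : (v j : ℝ) ≤ z j + 1 := by exact_mod_cast (hv j).2
  have h4 := mul_le_mul_of_nonneg_left h2 hn.le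
  have h5 := mul_le_mul_of_nonneg_left h3 hn.le
  split_ifs <;> constructor <;> linarith

/-- Points of the edges at distance less than 1 lie in the same member, so membership in `U`
propagates along edges from `z` to every vertex of the cube. -/
theorem linePoint_mem_of_cubeEdges_subset {n : ℕ+} {𝒰 : Set (Set XOmegaAddOne)}
    (hd : RDisjoint 1 𝒰) {z : Fin n → ℤ} (hz : cubeEdges n z ⊆ ⋃₀ 𝒰) {U : Set XOmegaAddOne}
    (hU : U ∈ 𝒰) (i : Fin n) (hzU : linePoint n z i 0 ∈ U) {v : Fin n → ℤ}
    (hv : ∀ j, z j ≤ v j ∧ v j ≤ z j + 1) : linePoint n v i 0 ∈ U := by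
  have key : ∀ x ∈ U, ∀ y ∈ cubeEdges n z, dist x y < 1 → y ∈ U := by
    intro x hx y hy hxy
    obtain ⟨W, hW, hyW⟩ := hz hy
    by_contra hyU
    have hne : U ≠ W := fun e => hyU (e ▸ hyW)
    exact absurd (hd U hU W hW hne x hx y hyW) (not_le.2 hxy)
  -- Each edge is traversed in `2 n` steps of length `1/2`.
  have edge : ∀ (v : Fin n → ℤ) (p : Fin n), (∀ j, z j ≤ v j ∧ v j ≤ z j + 1) →
      linePoint n v p 0 ∈ U → ∀ m : ℕ, m ≤ 2 * (n : ℕ) → linePoint n v p (m / 2) ∈ U := by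
    intro v p hv h0 m
    induction m with
    | zero => intro _; simpa using h0
    | succ m ih =>
      intro hm
      refine key _ (ih (by omega)) _ ⟨v, p, _, hv, by positivity, ?_, rfl⟩ ?_
      · have : ((m + 1 : ℕ) : ℝ) ≤ 2 * ((n : ℕ) : ℝ) := by exact_mod_cast hm
        linarith
      · refine lt_of_le_of_lt (dist_le_of_forall_fin (n := n) (c := 1 / 2) rfl rfl (by norm_num)
          fun j => ?_) (by norm_num)
        rw [extend_linePoint, extend_linePoint]
        split_ifs
        · rw [abs_le]; push_cast; constructor <;> linarith
        · simp
  have step : ∀ s : Finset (Fin n),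
      linePoint n (fun j => if j ∈ s then z j + 1 else z j) i 0 ∈ U := by
    intro s
    induction s using Finset.induction_on with
    | empty => simpa using hzU
    | insert p s hp ih =>
      have h1 := edge _ p (fun j => by split_ifs <;> omega)
        (linePoint_zero n _ i p ▸ ih) (2 * n) le_rfl
      rw [Nat.cast_mul, Nat.cast_two, mul_div_cancel_left₀ _ two_ne_zero, linePoint_self,
        linePoint_zero n _ p i] at h1
      convert h1 using 2
      funext j
      by_cases hj : j = p
      · subst hj; simp [hp]
      · simp [hj]
  have h := step (Finset.univ.filter fun j => v j ≠ z j)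
  convert h using 2
  funext j
  have := hv j
  by_cases hj : v j = z j
  · simp [hj]
  · simp [hj]; omega

/-- `X_n` is not covered by `n` uniformly bounded families one of which is `1`-disjoint and the
others of which are `(3 n + 1)`-disjoint. -/
theorem not_covered (n : ℕ+) (𝒰 : Fin n → Set (Set XOmegaAddOne)) (i₀ : Fin n)
    (hb : ∀ j, UniformlyBounded (𝒰 j)) (h0 : RDisjoint 1 (𝒰 i₀))
    (hd : ∀ j, j ≠ i₀ → RDisjoint (3 * n + 1) (𝒰 j))
    (hcov : ∀ x : XOmegaAddOne, x.1 = n → ∃ j, x ∈ ⋃₀ 𝒰 j) : False := by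
  have hn : (1 : ℝ) ≤ n := by exact_mod_cast one_le (a := n)
  -- The color `i₀` is used only as a last resort; in that case the family `𝒰 i₀` contains all edges
  -- of the cube.
  have hex : ∀ z : Fin n → ℤ, ∃ (c : Fin n) (U : Set XOmegaAddOne), U ∈ 𝒰 c ∧
      (∃ x ∈ U, x ∈ cubeEdges n z) ∧
      (c = i₀ → cubeEdges n z ⊆ ⋃₀ 𝒰 i₀ ∧ linePoint n z i₀ 0 ∈ U) := by
    intro z
    by_cases h : ∃ c, c ≠ i₀ ∧ ∃ U ∈ 𝒰 c, ∃ x ∈ U, x ∈ cubeEdges n z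
    · obtain ⟨c, hc, U, hU, hx⟩ := h
      exact ⟨c, U, hU, hx, fun e => absurd e hc⟩
    · push Not at h
      have hsub : cubeEdges n z ⊆ ⋃₀ 𝒰 i₀ := by
        intro x hx
        obtain ⟨j, U, hU, hxU⟩ := hcov x (fst_of_mem_cubeEdges hx)
        by_cases hj : j = i₀
        · exact ⟨U, hj ▸ hU, hxU⟩
        · exact absurd hx (h j hj U hU x hxU)
      have hmem : linePoint n z i₀ 0 ∈ cubeEdges n z :=
        ⟨z, i₀, 0, fun j => ⟨le_rfl, by omega⟩, le_rfl, by linarith, rfl⟩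
      obtain ⟨U, hU, hxU⟩ := hsub hmem
      exact ⟨i₀, U, hU, ⟨_, hxU, hmem⟩, fun _ => ⟨hsub, hxU⟩⟩
  choose color U hU hx hc using hex
  choose R hR0 hR using hb
  have hRle : ∀ j, R j ≤ ∑ j, R j := fun j =>
    Finset.single_le_sum (fun i _ => (hR0 i).le) (Finset.mem_univ j)
  have hlab : ∀ z z' : Fin n → ℤ, (∀ j, |z j - z' j| ≤ 1) → color z = color z' → U z = U z' := by
    intro z z' hz hcol
    by_contra hne
    by_cases h : color z = i₀
    -- The vertex `z ⊔ z'` is common to both cubes, so it lies in both members, which therefore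
    -- cannot be distinct.
    · have h1 : linePoint n (z ⊔ z') i₀ 0 ∈ U z :=
        linePoint_mem_of_cubeEdges_subset h0 (hc z h).1 (h ▸ hU z) i₀ (hc z h).2 fun j => by
          have := abs_le.1 (hz j)
          rw [Pi.sup_apply]; omega
      have h' := hcol ▸ h
      have h2 : linePoint n (z ⊔ z') i₀ 0 ∈ U z' :=
        linePoint_mem_of_cubeEdges_subset h0 (hc z' h').1 (h' ▸ hU z') i₀ (hc z' h').2
          fun j => by
            have := abs_le.1 (hz j)
            rw [Pi.sup_apply]; omega
      have h3 := h0 _ (h ▸ hU z) _ (h' ▸ hU z') hne _ h1 _ h2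
      rw [dist_self] at h3
      linarith
    · obtain ⟨x, hxU, hxz⟩ := hx z
      obtain ⟨y, hyU, hyz⟩ := hx z'
      have h1 := hd _ h _ (hU z) _ (hcol ▸ hU z') hne x hxU y hyU
      -- Each set of edges extends up to `2 n` above its corner in every coordinate, and the corners
      -- differ by at most `n`.
      have h2 : dist x y ≤ 3 * n := by
        refine dist_le_of_forall_fin (fst_of_mem_cubeEdges hxz) (fst_of_mem_cubeEdges hyz)
          (by linarith) fun j => ?_
        have h3 := extend_of_mem_cubeEdges hxz j
        have h4 := extend_of_mem_cubeEdges hyz j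
        have h5 := abs_le.1 (hz j)
        have h6 : (z j : ℝ) ≤ z' j + 1 := by exact_mod_cast (by omega : z j ≤ z' j + 1)
        have h7 : (z' j : ℝ) ≤ z j + 1 := by exact_mod_cast (by omega : z' j ≤ z j + 1)
        have h8 := mul_le_mul_of_nonneg_left h6 (zero_le_one.trans hn)
        have h9 := mul_le_mul_of_nonneg_left h7 (zero_le_one.trans hn)
        rw [abs_le]
        constructor <;> linarith
      linarith
  have hbdd : ∀ z z' : Fin n → ℤ, color z = color z' → U z = U z' → ∀ j,
      z j - z' j ≤ ⌈∑ j, R j⌉ + 2 := by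
    intro z z' hcol hl j
    obtain ⟨x, hxU, hxz⟩ := hx z
    obtain ⟨y, hyU, hyz⟩ := hx z'
    have h1 := (abs_extend_sub_le_dist x y j).trans
      ((hR _ _ (hU z) x hxU y (hl ▸ hyU)).trans (hRle _))
    have h2 := abs_le.1 h1
    have h3 := extend_of_mem_cubeEdges hxz j
    have h4 := extend_of_mem_cubeEdges hyz j
    by_contra hlt
    have h5 : (⌈∑ j, R j⌉ : ℝ) + 3 ≤ z j - z' j := by exact_mod_cast (by omega)
    have h6 := Int.le_ceil (∑ j, R j)
    have h7 : 0 ≤ ∑ j, R j := (abs_nonneg _).trans h1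
    have h8 : ∑ j, R j + 1 ≤ (z j : ℝ) - z' j - 2 := by linarith
    have h9 : (z j : ℝ) - z' j - 2 ≤ n * ((z j : ℝ) - z' j - 2) :=
      le_mul_of_one_le_left (by linarith) hn
    linarith
  -- Halving turns distance 2 into distance 1, where `hlab` applies; it turns the bound `C + 2` into
  -- `2 C + 5`.
  refine not_bounded_coloring (fun w => color fun j => w j / 2) (fun w => U fun j => w j / 2)
    (2 * ⌈∑ j, R j⌉ + 5) (fun w w' hw hcol => hlab _ _ (fun j => ?_) hcol)
    fun w w' hcol hl j => ?_
  · have := abs_le.1 (hw j)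
    rw [abs_le]; omega
  · have := hbdd _ _ hcol hl j
    omega

end XOmegaAddOne

/-! ### Families of fibers of a labeling -/

section FiberFamily

variable {X : Type u} {L : Type*}

/-- The family of the fibers of `lab` in `S`. -/
def fiberFamily (S : Set X) (lab : X → L) : Set (Set X) :=
  Set.range fun l => {x | x ∈ S ∧ lab x = l}

theorem sUnion_fiberFamily (S : Set X) (lab : X → L) : ⋃₀ fiberFamily S lab = S := by
  ext x
  constructor
  · rintro ⟨_, ⟨l, rfl⟩, hx⟩
    exact hx.1
  · exact fun hx => ⟨_, ⟨lab x, rfl⟩, hx, rfl⟩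

theorem uniformlyBounded_fiberFamily [MetricSpace X] {S : Set X} {lab : X → L} {R : ℝ}
    (hR : 0 < R) (h : ∀ x ∈ S, ∀ y ∈ S, lab x = lab y → dist x y ≤ R) :
    UniformlyBounded (fiberFamily S lab) := by
  refine ⟨R, hR, ?_⟩
  rintro _ ⟨l, rfl⟩ x hx y hy
  exact h x hx.1 y hy.1 (hx.2.trans hy.2.symm)

theorem rDisjoint_fiberFamily [MetricSpace X] {S : Set X} {lab : X → L} {r : ℝ}
    (h : ∀ x ∈ S, ∀ y ∈ S, lab x ≠ lab y → r ≤ dist x y) :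
    RDisjoint r (fiberFamily S lab) := by
  rintro _ ⟨l, rfl⟩ _ ⟨l', rfl⟩ hne x hx y hy
  refine h x hx.1 y hy.1 fun e => hne ?_
  have : l = l' := hx.2.symm.trans (e.trans hy.2)
  rw [this]

theorem RDisjoint.mono [MetricSpace X] {𝒰 : Set (Set X)} {r s : ℝ} (h : RDisjoint r 𝒰)
    (hs : s ≤ r) : RDisjoint s 𝒰 :=
  fun U hU V hV hne x hx y hy => hs.trans (h U hU V hV hne x hx y hy)

end FiberFamily

/-! ### Covers of the high and the low part of the space -/

namespace XOmegaAddOne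

theorem min_le_gap {p q : ℕ} (h : p ≠ q) : ((min p q : ℕ) : ℝ) ≤ gap p q := by
  unfold gap
  exact Finset.single_le_sum (f := fun i : ℕ => (i : ℝ)) (fun i _ => Nat.cast_nonneg i)
    (Finset.mem_Ico.2 ⟨le_rfl, min_lt_max.2 h⟩)

theorem exists_forall_ne_extend (x : XOmegaAddOne) :
    ∃ i : ℕ, ∀ j, j ≠ i → ∃ k : ℤ, x.extend j = ((x.1 : ℕ) : ℝ) * k := by
  obtain ⟨n, x, i, hi⟩ := x
  refine ⟨i, fun j hj => ?_⟩
  by_cases h : j < n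
  · obtain ⟨k, hk⟩ := hi ⟨j, h⟩ fun e => hj (by rw [← e])
    refine ⟨k, ?_⟩
    rw [← hk]
    exact dif_pos h
  · exact ⟨0, (extend_eq_zero (not_lt.1 h)).trans (by simp)⟩

/-- The even factor `2 * L` makes lattice coordinates even multiples of the mesh. -/
theorem exists_mesh {r : ℝ} (hr : 0 < r) {m : ℝ} (hm : 4 * r ≤ m) :
    ∃ (L : ℕ) (s : ℝ), 2 * r ≤ s ∧ s ≤ 4 * r ∧ m = 2 * L * s := by
  have h4 : 0 < 4 * r := by linarith
  have h1 : 1 ≤ m / (4 * r) := (one_le_div h4).2 hm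
  have hL1 : 1 ≤ ⌊m / (4 * r)⌋₊ := Nat.le_floor (by simpa using h1)
  have hL2 := Nat.floor_le (zero_le_one.trans h1)
  have hL3 := Nat.lt_floor_add_one (m / (4 * r))
  generalize ⌊m / (4 * r)⌋₊ = L at hL1 hL2 hL3
  have hL : (1 : ℝ) ≤ L := by exact_mod_cast hL1
  rw [le_div_iff₀ h4] at hL2
  rw [div_lt_iff₀ h4] at hL3
  refine ⟨L, m / (2 * L), ?_, ?_, ?_⟩
  · rw [le_div_iff₀ (by linarith)]; linarith
  · rw [div_le_iff₀ (by linarith)]; nlinarith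
  · field_simp

theorem exists_rDisjoint_cover_high {r : ℝ} (hr : 0 < r) {M : ℕ} (hM : 4 * r ≤ M) :
    ∃ 𝒰 : Fin 2 → Set (Set XOmegaAddOne),
      (∀ i, UniformlyBounded (𝒰 i) ∧ RDisjoint r (𝒰 i)) ∧
      ⋃ i, ⋃₀ 𝒰 i = {x : XOmegaAddOne | M ≤ (x.1 : ℕ)} := by
  have hmesh : ∀ m : ℕ, ∃ (L : ℕ) (s : ℝ), M ≤ m → 2 * r ≤ s ∧ s ≤ 4 * r ∧ (m : ℝ) = 2 * L * s := by
    intro m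
    by_cases h : M ≤ m
    · obtain ⟨L, s, hs⟩ := exists_mesh hr (hM.trans (Nat.cast_le.2 h))
      exact ⟨L, s, fun _ => hs⟩
    · exact ⟨0, 0, fun h' => absurd h' h⟩
  choose L s hs using hmesh
  let v : XOmegaAddOne → ℕ → ℤ := fun x j => round (x.extend j / s x.1)
  let lab : XOmegaAddOne → ℕ × (ℕ → ℤ) := fun x => (x.1, v x)
  let S : Fin 2 → Set XOmegaAddOne :=
    ![{x | M ≤ (x.1 : ℕ) ∧ ∀ j, Even (v x j)}, {x | M ≤ (x.1 : ℕ) ∧ ¬ ∀ j, Even (v x j)}]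
  have hSM : ∀ i, ∀ x ∈ S i, M ≤ (x.1 : ℕ) := by
    intro i x hx
    fin_cases i
    · exact hx.1
    · exact hx.1
  have hv : ∀ x j, |x.extend j / s x.1 - v x j| ≤ 1 / 2 := fun x j => abs_sub_round _
  have hdist : ∀ x y : XOmegaAddOne, M ≤ (x.1 : ℕ) → (x.1 : ℕ) = y.1 → ∀ j,
      1 / 2 ≤ |x.extend j / s x.1 - y.extend j / s y.1| → r ≤ dist x y := by
    intro x y hx hxy j h
    refine le_trans ?_ (abs_extend_sub_le_dist x y j)
    obtain ⟨h1, -, -⟩ := hs _ hx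
    rw [← hxy, ← sub_div, abs_div, abs_of_pos (by linarith : 0 < s x.1),
      le_div_iff₀ (by linarith)] at h
    linarith
  have hlat : ∀ x : XOmegaAddOne, M ≤ (x.1 : ℕ) → ∃ i, ∀ j, j ≠ i →
      ∃ k : ℤ, x.extend j / s x.1 = ((2 * k : ℤ) : ℝ) := by
    intro x hx
    obtain ⟨i, hi⟩ := exists_forall_ne_extend x
    refine ⟨i, fun j hj => ?_⟩
    obtain ⟨k, hk⟩ := hi j hj
    obtain ⟨h1, -, h2⟩ := hs _ hx
    refine ⟨L x.1 * k, ?_⟩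
    rw [div_eq_iff (by linarith), hk, h2]
    push_cast
    ring
  have hdist2 : ∀ x y : XOmegaAddOne, M ≤ (x.1 : ℕ) → (x.1 : ℕ) = y.1 → ∀ j,
      (Even (v x j) ↔ Even (v y j)) → v x j ≠ v y j → r ≤ dist x y := by
    intro x y hx hxy j hpar hne
    refine hdist x y hx hxy j ?_
    have h1 := abs_le.1 (hv x j)
    have h2 := abs_le.1 (hv y j)
    rw [Int.even_iff, Int.even_iff] at hpar
    rw [le_abs]
    rcases (by omega : v x j + 2 ≤ v y j ∨ v y j + 2 ≤ v x j) with h | h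
    · right
      have : (v x j : ℝ) + 2 ≤ v y j := by exact_mod_cast h
      linarith
    · left
      have : (v y j : ℝ) + 2 ≤ v x j := by exact_mod_cast h
      linarith
  have hodd : ∀ x : XOmegaAddOne, M ≤ (x.1 : ℕ) → (¬ ∀ j, Even (v x j)) → ∃ i, ¬ Even (v x i) ∧
      ∀ j, j ≠ i → Even (v x j) ∧ ∃ k : ℤ, x.extend j / s x.1 = ((2 * k : ℤ) : ℝ) := by
    intro x hx h
    obtain ⟨i, hi⟩ := hlat x hx
    have he : ∀ j, j ≠ i → Even (v x j) := by
      intro j hj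
      obtain ⟨k, hk⟩ := hi j hj
      simp only [v, hk, round_intCast]
      exact even_two_mul k
    refine ⟨i, fun hii => h fun j => ?_, fun j hj => ⟨he j hj, hi j hj⟩⟩
    by_cases hj : j = i
    · exact hj ▸ hii
    · exact he j hj
  refine ⟨fun i => fiberFamily (S i) lab, fun i => ⟨?_, ?_⟩, ?_⟩
  · refine uniformlyBounded_fiberFamily (R := 4 * r) (by linarith) fun x hx y hy hl => ?_
    have hl1 : (x.1 : ℕ) = y.1 := congrArg Prod.fst hl
    have hl2 : v x = v y := congrArg Prod.snd hl
    refine dist_le_of_fst_eq (PNat.coe_injective hl1) fun j => ?_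
    obtain ⟨h1, h2, -⟩ := hs _ (hSM i x hx)
    have h3 := hv x j
    have h4 := hv y j
    rw [← hl2, ← hl1] at h4
    have h5 : |x.extend j / s x.1 - y.extend j / s x.1| ≤ 1 := by
      rw [abs_le] at *
      constructor <;> linarith
    rw [← sub_div, abs_div, abs_of_pos (by linarith : 0 < s x.1),
      div_le_iff₀ (by linarith)] at h5
    linarith
  · refine rDisjoint_fiberFamily fun x hx y hy hl => ?_
    have hxM := hSM i x hx
    have hyM := hSM i y hy
    by_cases hxy : (x.1 : ℕ) = y.1
    swap
    · refine le_trans ?_ ((min_le_gap hxy).trans (gap_le_dist x y))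
      have : (M : ℝ) ≤ ((min (x.1 : ℕ) y.1 : ℕ) : ℝ) := by exact_mod_cast le_min hxM hyM
      linarith
    obtain ⟨j, hj⟩ : ∃ j, v x j ≠ v y j := by
      by_contra! h
      exact hl (Prod.ext hxy (funext h))
    fin_cases i
    · exact hdist2 x y hxM hxy j (iff_of_true (hx.2 j) (hy.2 j)) hj
    · obtain ⟨i, hi, hi'⟩ := hodd x hxM hx.2
      obtain ⟨p, hp, hp'⟩ := hodd y hyM hy.2
      by_cases hip : i = p
      · subst hip
        refine hdist2 x y hxM hxy j ?_ hj
        by_cases hji : j = i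
        · subst hji
          exact iff_of_false hi hp
        · exact iff_of_true (hi' j hji).1 (hp' j hji).1
      -- The exceptional directions differ, so coordinate `i` of `y` is exactly an even multiple of
      -- the mesh, while that of `x` rounds to an odd one: they are at least half a mesh apart.
      · refine hdist x y hxM hxy i ?_
        obtain ⟨k, hk⟩ := (hp' i hip).2
        rw [hk, le_abs]
        have h1 := abs_le.1 (hv x i)
        rw [Int.even_iff] at hi
        rcases (by omega : v x i + 1 ≤ 2 * k ∨ 2 * k + 1 ≤ v x i) with h | h
        · right
          have : (v x i : ℝ) + 1 ≤ ((2 * k : ℤ) : ℝ) := by exact_mod_cast h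
          linarith
        · left
          have : ((2 * k : ℤ) : ℝ) + 1 ≤ v x i := by exact_mod_cast h
          linarith
  · simp only [sUnion_fiberFamily]
    ext x
    simp only [Set.mem_iUnion, Fin.exists_fin_two, S, Matrix.cons_val_zero, Matrix.cons_val_one,
      Set.mem_ofPred_eq]
    tauto

/-- Cut each `X_m` into half-open boxes of side `r` and sort them by `m` and by the parities of
their positions in `M` coordinates. The number of classes does not depend on `r`. -/
theorem exists_rDisjoint_cover_low {M : ℕ} (hM : 0 < M) :
    ∃ n : ℕ, ∀ r : ℝ, 0 < r → ∃ 𝒰 : Fin (n + 1) → Set (Set XOmegaAddOne),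
      (∀ i, UniformlyBounded (𝒰 i) ∧ RDisjoint r (𝒰 i)) ∧
      ⋃ i, ⋃₀ 𝒰 i = {x : XOmegaAddOne | (x.1 : ℕ) < M} := by
  classical
  have : Nonempty (Fin M) := ⟨⟨0, hM⟩⟩
  obtain ⟨n, hn⟩ := Nat.exists_eq_succ_of_ne_zero
    (Fintype.card_ne_zero (α := Fin M × (Fin M → Bool)))
  let e := (Fintype.equivFinOfCardEq hn).symm
  refine ⟨n, fun r hr => ?_⟩
  let v : XOmegaAddOne → ℕ → ℤ := fun x j => ⌊x.extend j / r⌋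
  let S : Fin (n + 1) → Set XOmegaAddOne := fun i =>
    {x | (x.1 : ℕ) = (e i).1 ∧ ∀ j : Fin M, (e i).2 j = decide (Even (v x j))}
  refine ⟨fun i => fiberFamily (S i) v, fun i => ⟨?_, ?_⟩, ?_⟩
  · refine uniformlyBounded_fiberFamily hr fun x hx y hy hl => ?_
    refine dist_le_of_fst_eq (PNat.coe_injective (hx.1.trans hy.1.symm)) fun j => ?_
    have h := Int.abs_sub_lt_one_of_floor_eq_floor (congrFun hl j)
    rw [← sub_div, abs_div, abs_of_pos hr, div_lt_one hr] at h
    exact h.le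
  · refine rDisjoint_fiberFamily fun x hx y hy hl => ?_
    obtain ⟨j, hj⟩ := Function.ne_iff.1 hl
    refine le_trans ?_ (abs_extend_sub_le_dist x y j)
    have hjM : j < M := by
      by_contra h
      have hlt := (e i).1.is_lt
      refine hj ?_
      simp only [v]
      rw [extend_eq_zero (by have := hx.1; omega), extend_eq_zero (by have := hy.1; omega)]
    have hpar : Even (v x j) ↔ Even (v y j) :=
      decide_eq_decide.1 ((hx.2 ⟨j, hjM⟩).symm.trans (hy.2 ⟨j, hjM⟩))
    rw [Int.even_iff, Int.even_iff] at hpar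
    have h1 : 1 ≤ |x.extend j / r - y.extend j / r| := by
      have a1 : (v x j : ℝ) ≤ x.extend j / r := Int.floor_le _
      have a2 : x.extend j / r < v x j + 1 := Int.lt_floor_add_one _
      have a3 : (v y j : ℝ) ≤ y.extend j / r := Int.floor_le _
      have a4 : y.extend j / r < v y j + 1 := Int.lt_floor_add_one _
      rw [le_abs]
      rcases (by omega : v x j + 2 ≤ v y j ∨ v y j + 2 ≤ v x j) with h | h
      · right
        have : (v x j : ℝ) + 2 ≤ v y j := by exact_mod_cast h
        linarith
      · left
        have : (v y j : ℝ) + 2 ≤ v x j := by exact_mod_cast h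
        linarith
    rwa [← sub_div, abs_div, abs_of_pos hr, one_le_div hr] at h1
  · simp only [sUnion_fiberFamily]
    ext x
    simp only [Set.mem_iUnion, Set.mem_ofPred_eq]
    constructor
    · rintro ⟨i, hi, -⟩
      rw [hi]
      exact (e i).1.is_lt
    · intro hx
      refine ⟨e.symm (⟨x.1, hx⟩, fun j => decide (Even (v x j))), ?_⟩
      simp [S]

end XOmegaAddOne

/-! ### Finite values of `Ord` and of `coasdim` -/

section FinOrd

/-- Passing to a residual at an element of `σ` removes that element and lowers the ordinal. The
alternative `σ = ∅` is there because `M` is arbitrary. -/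
theorem card_le_of_finOrdLE {n : ℕ} {M : Set (Finset ℕ+)} (h : FinOrdLE M n)
    {σ : Finset ℕ+} (hσ : σ ∈ M) : σ.card ≤ n ∨ σ = ∅ := by
  induction n using Nat.strong_induction_on generalizing M σ with
  | _ n ih =>
    rw [or_iff_not_imp_right, ← ne_eq, ← Finset.nonempty_iff_ne_empty]
    rintro ⟨a, ha⟩
    rw [FinOrdLE] at h
    rcases h with rfl | h
    · exact absurd hσ (Set.notMem_empty σ)
    · obtain ⟨β, hβ, h⟩ := h a
      obtain ⟨m, rfl⟩ := Ordinal.lt_omega0.1 (hβ.trans (Ordinal.natCast_lt_omega0 n))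
      have hm : m < n := by exact_mod_cast hβ
      have hcard := Finset.card_erase_add_one ha
      rcases (σ.erase a).eq_empty_or_nonempty with he | he
      · rw [he, Finset.card_empty] at hcard
        omega
      · have hmem : σ.erase a ∈ finResidual M {a} := by
          refine ⟨he, ?_, by simp⟩
          rwa [Finset.union_comm, ← Finset.insert_eq, Finset.insert_erase ha]
        rcases ih m hm h hmem with h' | h'
        · omega
        · exact absurd h' he.ne_empty

theorem finOrdLE_of_card_le {n : ℕ} {M : Set (Finset ℕ+)} (hne : ∀ σ ∈ M, σ.Nonempty)
    (h : ∀ σ ∈ M, σ.card ≤ n) : FinOrdLE M n := by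
  induction n generalizing M with
  | zero =>
    rw [FinOrdLE]
    left
    refine Set.eq_empty_of_forall_notMem fun σ hσ => ?_
    exact absurd (h σ hσ) (not_le.2 (hne σ hσ).card_pos)
  | succ n ih =>
    rw [FinOrdLE]
    right
    refine fun a => ⟨n, by exact_mod_cast n.lt_succ_self, ih (fun σ hσ => hσ.1) fun σ hσ => ?_⟩
    have h1 := h _ hσ.2.1
    rw [Finset.card_union_of_disjoint (Finset.disjoint_iff_inter_eq_empty.2 hσ.2.2),
      Finset.card_singleton] at h1
    omega

theorem finOrd_eq {M : Set (Finset ℕ+)} {α : Ordinal.{0}} (h : FinOrdLE M α)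
    (hlt : ∀ β < α, ¬ FinOrdLE M β) : finOrd M = α := by
  have : IsLeast {α | FinOrdLE M α} α := ⟨h, fun β hβ => not_lt.1 fun hlt' => hlt β hlt' hβ⟩
  rw [finOrd, if_pos ⟨α, h⟩, this.csInf_eq]

theorem coasdim_eq {X : Type u} [MetricSpace X] [Nonempty X] {γ : Ordinal.{u}}
    (h : CoasdimLE (Set.univ : Set X) γ)
    (hlt : ∀ β < γ, ¬ CoasdimLE (Set.univ : Set X) β) :
    coasdim X = ((γ : WithTop Ordinal.{u}) : WithBot (WithTop Ordinal.{u})) := by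
  have : IsLeast {γ | CoasdimLE (Set.univ : Set X) γ} γ :=
    ⟨h, fun β hβ => not_lt.1 fun hlt' => hlt β hlt' hβ⟩
  rw [coasdim, if_neg (not_isEmpty_of_nonempty X), if_pos ⟨γ, h⟩, this.csInf_eq]

/-- For finite ordinals, a bound on `coasdim A` is a bound on the asymptotic dimension. -/
theorem CoasdimLE.exists_cover {X : Type u} [MetricSpace X] {A : Set X} {γ : Ordinal.{u}}
    (h : CoasdimLE A γ) (hγ : γ < Ordinal.omega0) :
    ∃ n : ℕ, ∀ r : ℝ, 0 < r → ∃ 𝒰 : Fin (n + 1) → Set (Set X),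
      (∀ i, UniformlyBounded (𝒰 i) ∧ RDisjoint r (𝒰 i)) ∧ A ⊆ ⋃ i, ⋃₀ 𝒰 i := by
  rw [CoasdimLE] at h
  obtain ⟨l, n, rfl, hl, h⟩ := h
  have hl0 : l = 0 := hl.resolve_right fun hl =>
    absurd ((Ordinal.omega0_le_of_isSuccLimit hl).trans le_self_add) (not_le.2 hγ)
  subst hl0
  refine ⟨n, fun r hr => ?_⟩
  obtain ⟨𝒰, h1, h2⟩ := h r hr
  refine ⟨𝒰, fun i => ⟨(h1 i).1, (h1 i).2.1⟩, ?_⟩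
  rcases h2 with h2 | ⟨β, hβ, -⟩
  · exact Set.sdiff_eq_empty.1 h2
  · exact absurd hβ not_lt_zero

end FinOrd

/-! ### Both dimensions equal `ω + 1` -/

namespace XOmegaAddOne

theorem finOrdLE_obstructionSet :
    FinOrdLE (obstructionSet XOmegaAddOne) (Ordinal.omega0 + 1) := by
  classical
  rw [FinOrdLE]
  refine Or.inr fun a => ⟨Ordinal.omega0, lt_add_one _, ?_⟩
  rw [FinOrdLE]
  refine Or.inr fun b => ?_
  set r₀ : ℝ := max a b with hr₀
  have hr₀1 : (1 : ℝ) ≤ r₀ := le_max_of_le_left (by exact_mod_cast one_le (a := a))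
  have hM : 4 * r₀ ≤ (⌈4 * r₀⌉₊ : ℕ) := Nat.le_ceil _
  obtain ⟨n, hn⟩ := exists_rDisjoint_cover_low (M := ⌈4 * r₀⌉₊) (Nat.ceil_pos.2 (by linarith))
  refine ⟨n, Ordinal.natCast_lt_omega0 n, finOrdLE_of_card_le (fun τ hτ => hτ.1) ?_⟩
  rintro τ ⟨hτne, ⟨-, hσ, ha⟩, hb⟩
  have hbτ : b ∉ τ := by
    rw [← Finset.disjoint_iff_inter_eq_empty] at hb
    simpa using hb
  have haτ : a ∉ τ ∧ a ≠ b := by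
    rw [← Finset.disjoint_iff_inter_eq_empty] at ha
    simpa [and_comm] using ha
  by_contra! hcard
  refine hσ.2 ?_
  -- The sum bounds every index in `τ`, so each low family may be assigned to any of them.
  obtain ⟨𝒲, hW, hWcov⟩ := hn (∑ i ∈ τ, (i : ℝ))
    (Finset.sum_pos (fun i _ => by exact_mod_cast i.pos) hτne)
  obtain ⟨𝒱, hV, hVcov⟩ := exists_rDisjoint_cover_high (by linarith) hM
  obtain ⟨τ', hτ', hcard'⟩ := Finset.exists_subset_card_eq hcard
  let e := τ'.equivFinOfCardEq hcard'
  -- The indices in `τ'` already use every low family; the superfluous ones repeat family 0.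
  let q : ℕ+ → Fin (n + 1) := fun i => if h : i ∈ τ' then e ⟨i, h⟩ else 0
  refine ⟨fun i => if i = a then 𝒱 0 else if i = b then 𝒱 1 else 𝒲 (q i), fun i hi => ?_, ?_⟩
  · by_cases hia : i = a
    · simp only [hia, if_true]
      exact ⟨(hV 0).1, (hV 0).2.mono (le_max_left _ _)⟩
    by_cases hib : i = b
    · simp only [hib, haτ.2.symm, if_true, if_false]
      exact ⟨(hV 1).1, (hV 1).2.mono (le_max_right _ _)⟩
    simp only [hia, hib, if_false]
    have hiτ : i ∈ τ := by simpa [hia, hib] using hi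
    exact ⟨(hW _).1, (hW _).2.mono
      (Finset.single_le_sum (f := fun i : ℕ+ => (i : ℝ)) (fun j _ => by positivity) hiτ)⟩
  · refine Set.eq_univ_of_forall fun x => ?_
    rcases lt_or_ge (x.1 : ℕ) ⌈4 * r₀⌉₊ with hx | hx
    · have hx' : x ∈ ⋃ i, ⋃₀ 𝒲 i := hWcov ▸ hx
      obtain ⟨i, hi⟩ := Set.mem_iUnion.1 hx'
      have hp := (e.symm i).2
      refine Set.mem_iUnion₂.2 ⟨e.symm i, by simp [hτ' hp], ?_⟩
      have h1 : ((e.symm i : τ') : ℕ+) ≠ a := fun h => haτ.1 (h ▸ hτ' hp)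
      have h2 : ((e.symm i : τ') : ℕ+) ≠ b := fun h => hbτ (h ▸ hτ' hp)
      simpa [h1, h2, q] using hi
    · have hx' : x ∈ ⋃ i, ⋃₀ 𝒱 i := hVcov ▸ hx
      obtain ⟨i, hi⟩ := Set.mem_iUnion.1 hx'
      fin_cases i
      · exact Set.mem_iUnion₂.2 ⟨a, by simp, by simpa using hi⟩
      · exact Set.mem_iUnion₂.2 ⟨b, by simp, by simpa [haτ.2.symm] using hi⟩

theorem not_finOrdLE_obstructionSet {α : Ordinal.{0}} (hα : α ≤ Ordinal.omega0) :
    ¬ FinOrdLE (obstructionSet XOmegaAddOne) α := by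
  classical
  have key : ∀ n : ℕ, ∃ τ ∈ finResidual (obstructionSet XOmegaAddOne) {1}, n < τ.card := by
    intro n
    let k : ℕ+ := ⟨n + 2, by omega⟩
    -- The scales required by `not_covered` in `X_{n+2}`: once 1, and otherwise distinct integers at
    -- least `3 (n + 2) + 1`.
    let g : Fin (n + 2) → ℕ+ := fun j => if j = 0 then 1 else ⟨3 * (n + 2) + j, by omega⟩
    have hg0 : g 0 = 1 := if_pos rfl
    have hg : ∀ j, j ≠ 0 → (g j : ℕ) = 3 * (n + 2) + j := fun j hj => by simp [g, hj]
    have hginj : Function.Injective g := by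
      intro i j hij
      by_cases hi : i = 0 <;> by_cases hj : j = 0
      · rw [hi, hj]
      · have := hg j hj
        rw [← hij, hi, hg0] at this
        simp at this; omega
      · have := hg i hi
        rw [hij, hj, hg0] at this
        simp at this; omega
      · have h1 := hg i hi
        have h2 := hg j hj
        rw [hij, h2] at h1
        exact Fin.ext (by omega)
    have himg : Finset.univ.image g = (Finset.univ.erase 0).image g ∪ {1} := by
      rw [← hg0, ← Finset.image_singleton, ← Finset.image_union, Finset.union_comm,
        ← Finset.insert_eq, Finset.insert_erase (Finset.mem_univ _)]
    have hcard : ((Finset.univ.erase 0).image g).card = n + 1 := by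
      rw [Finset.card_image_of_injective _ hginj, Finset.card_erase_of_mem (Finset.mem_univ _)]
      simp
    refine ⟨(Finset.univ.erase 0).image g, ⟨?_, ?_, ?_⟩, by omega⟩
    · exact Finset.card_pos.1 (by omega)
    · rw [← himg]
      refine ⟨Finset.univ_nonempty.image g, ?_⟩
      rintro ⟨𝒰, h1, h2⟩
      refine not_covered k (fun j => 𝒰 (g j)) (0 : Fin (n + 2))
        (fun j => (h1 _ (Finset.mem_image_of_mem g (Finset.mem_univ _))).1) ?_ (fun j hj => ?_)
        fun x _ => ?_
      · have := (h1 _ (Finset.mem_image_of_mem g (Finset.mem_univ 0))).2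
        rw [hg0] at this ⊢
        simpa using this
      · refine (h1 _ (Finset.mem_image_of_mem g (Finset.mem_univ _))).2.mono ?_
        rw [hg j hj]
        have : 1 ≤ (j : ℕ) := Nat.one_le_iff_ne_zero.2 fun h => hj (Fin.ext h)
        have hk : (k : ℕ) = n + 2 := rfl
        rw [hk]
        exact_mod_cast Nat.add_le_add_left this _
      · have hx : x ∈ ⋃ i ∈ Finset.univ.image g, ⋃₀ 𝒰 i := h2 ▸ Set.mem_univ x
        obtain ⟨i, hi, hxi⟩ := Set.mem_iUnion₂.1 hx
        obtain ⟨j, -, rfl⟩ := Finset.mem_image.1 hi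
        exact ⟨j, hxi⟩
    · rw [← Finset.disjoint_iff_inter_eq_empty, Finset.disjoint_singleton_right,
        Finset.mem_image]
      rintro ⟨j, hj, h⟩
      exact (Finset.mem_erase.1 hj).1 (hginj (h.trans hg0.symm))
  intro h
  rw [FinOrdLE] at h
  rcases h with h | h
  · obtain ⟨τ, hτ, -⟩ := key 0
    rw [h] at hτ
    exact hτ.2.1
  · obtain ⟨β, hβ, h⟩ := h 1
    obtain ⟨n, rfl⟩ := Ordinal.lt_omega0.1 (hβ.trans_le hα)
    obtain ⟨τ, hτ, hcard⟩ := key n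
    rcases card_le_of_finOrdLE h hτ with h' | h'
    · omega
    · exact hτ.1.ne_empty h'

theorem coasdimLE_univ : CoasdimLE (Set.univ : Set XOmegaAddOne) (Ordinal.omega0 + 1) := by
  rw [CoasdimLE]
  refine ⟨Ordinal.omega0, 1, by simp, Or.inr Ordinal.isSuccLimit_omega0, fun r hr => ?_⟩
  have hM : 4 * r ≤ (⌈4 * r⌉₊ : ℕ) := Nat.le_ceil _
  obtain ⟨n, hn⟩ := exists_rDisjoint_cover_low (M := ⌈4 * r⌉₊) (Nat.ceil_pos.2 (by linarith))
  obtain ⟨𝒱, hV, hVcov⟩ := exists_rDisjoint_cover_high hr hM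
  refine ⟨𝒱, fun i => ⟨(hV i).1, (hV i).2, fun _ _ => Set.subset_univ _⟩,
    Or.inr ⟨n, Ordinal.natCast_lt_omega0 n, ?_⟩⟩
  have hlow : Set.univ \ ⋃ i, ⋃₀ 𝒱 i = {x : XOmegaAddOne | (x.1 : ℕ) < ⌈4 * r⌉₊} := by
    rw [hVcov]
    ext x
    simp only [Set.mem_sdiff, Set.mem_univ, Set.mem_ofPred_eq, not_le, true_and]
  rw [hlow, CoasdimLE]
  refine ⟨0, n, by simp, Or.inl rfl, fun s hs => ?_⟩
  obtain ⟨𝒲, hW, hWcov⟩ := hn s hs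
  refine ⟨𝒲, fun i => ⟨(hW i).1, (hW i).2, fun U hU => ?_⟩, Or.inl ?_⟩
  · rw [← hWcov]
    exact (Set.subset_sUnion_of_mem hU).trans (Set.subset_iUnion (fun i => ⋃₀ 𝒲 i) i)
  · rw [hWcov, Set.sdiff_self]

/-- Adding `𝒱` to `n + 1` families at scale `3 (n + 2) + 1` would cover `X_{n+2}`. -/
theorem not_compl_covered {𝒱 : Set (Set XOmegaAddOne)} (hb : UniformlyBounded 𝒱)
    (hd : RDisjoint 1 𝒱) (n : ℕ) :
    ¬ ∀ r : ℝ, 0 < r → ∃ 𝒰 : Fin (n + 1) → Set (Set XOmegaAddOne),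
      (∀ i, UniformlyBounded (𝒰 i) ∧ RDisjoint r (𝒰 i)) ∧ (⋃₀ 𝒱)ᶜ ⊆ ⋃ i, ⋃₀ 𝒰 i := by
  intro h
  let k : ℕ+ := ⟨n + 2, by omega⟩
  obtain ⟨𝒰, h1, h2⟩ := h (3 * k + 1) (by positivity)
  refine not_covered k (Fin.cons 𝒱 𝒰 : Fin (n + 2) → _) (0 : Fin (n + 2)) ?_ hd ?_ fun x _ => ?_
  · exact Fin.cases hb fun j => (h1 j).1
  · exact Fin.cases (fun h => absurd rfl h) fun j _ => (h1 j).2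
  · by_cases hx : x ∈ ⋃₀ 𝒱
    · exact ⟨(0 : Fin (n + 2)), hx⟩
    · obtain ⟨j, hj⟩ := Set.mem_iUnion.1 (h2 hx)
      exact ⟨j.succ, hj⟩

theorem not_coasdimLE_univ {γ : Ordinal.{0}} (hγ : γ ≤ Ordinal.omega0) :
    ¬ CoasdimLE (Set.univ : Set XOmegaAddOne) γ := by
  have hempty : UniformlyBounded (∅ : Set (Set XOmegaAddOne)) ∧
      RDisjoint 1 (∅ : Set (Set XOmegaAddOne)) :=
    ⟨⟨1, one_pos, fun U hU => hU.elim⟩, fun U hU => hU.elim⟩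
  intro h
  rcases hγ.lt_or_eq with hlt | rfl
  -- A finite bound is excluded by taking the empty family for `𝒱`.
  · obtain ⟨n, hn⟩ := h.exists_cover hlt
    exact not_compl_covered hempty.1 hempty.2 n (by simpa using hn)
  · rw [CoasdimLE] at h
    obtain ⟨l, n, hln, hl, h⟩ := h
    rcases hl with rfl | hl
    · rw [zero_add] at hln
      exact absurd hln (Ordinal.natCast_lt_omega0 n).ne'
    -- A decomposition of `ω` with limit part `l` has `l = ω` and `n = 0`, so only one family may be
    -- removed before the remainder must have finite dimension.
    · have hn : n = 0 := by
        have h1 : Ordinal.omega0 + (n : Ordinal.{0}) ≤ Ordinal.omega0 + 0 := by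
          rw [add_zero]
          conv_rhs => rw [hln]
          gcongr
          exact Ordinal.omega0_le_of_isSuccLimit hl
        simpa using h1
      subst hn
      have hlω : l = Ordinal.omega0 := by simpa using hln.symm
      subst hlω
      obtain ⟨𝒱, hV, hVcov⟩ := h 1 one_pos
      have hU : ⋃ i, ⋃₀ 𝒱 i = ⋃₀ 𝒱 0 := by
        ext x
        simp [Fin.exists_fin_one]
      rw [hU, ← Set.compl_eq_univ_sdiff] at hVcov
      rcases hVcov with hc | ⟨β, hβ, hc⟩
      · exact not_compl_covered (hV 0).1 (hV 0).2.1 0 fun r _ =>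
          ⟨fun _ => ∅, fun _ => ⟨hempty.1, fun U hU => hU.elim⟩, by rw [hc]; exact Set.empty_subset _⟩
      · obtain ⟨n, hn⟩ := hc.exists_cover hβ
        exact not_compl_covered (hV 0).1 (hV 0).2.1 n hn

instance : Nonempty XOmegaAddOne := ⟨linePoint 1 0 (0 : Fin 1) 0⟩

theorem trasdim_eq :
    trasdim XOmegaAddOne = ((Ordinal.omega0 + 1 : Ordinal.{0}) : WithTop Ordinal.{0}) :=
  finOrd_eq finOrdLE_obstructionSet fun _ hβ =>
    not_finOrdLE_obstructionSet (Order.lt_add_one_iff.1 hβ)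

end XOmegaAddOne

theorem mainTheorem1 :
    trasdim XOmegaAddOne = ((Ordinal.omega0 + 1 : Ordinal.{0}) : WithTop Ordinal.{0}) ∧
    coasdim XOmegaAddOne =
      (((Ordinal.omega0 + 1 : Ordinal.{0}) : WithTop Ordinal.{0}) :
        WithBot (WithTop Ordinal.{0})) ∧
    ¬ (∀ (X : Type) [MetricSpace X],
        ((Ordinal.omega0 : Ordinal.{0}) : WithTop Ordinal.{0}) ≤ trasdim X → trasdim X < ⊤ →
          trasdim X = ((Ordinal.omega0 : Ordinal.{0}) : WithTop Ordinal.{0})) := by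
  refine ⟨XOmegaAddOne.trasdim_eq, coasdim_eq XOmegaAddOne.coasdimLE_univ fun _ hβ =>
    XOmegaAddOne.not_coasdimLE_univ (Order.lt_add_one_iff.1 hβ), fun h => ?_⟩
  have h1 := h XOmegaAddOne
    (by rw [XOmegaAddOne.trasdim_eq]; exact WithTop.coe_le_coe.2 (lt_add_one _).le)
    (by rw [XOmegaAddOne.trasdim_eq]; exact WithTop.coe_lt_top _)
  rw [XOmegaAddOne.trasdim_eq] at h1
  exact (lt_add_one Ordinal.omega0).ne' (WithTop.coe_injective h1)
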